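/- Let $K$ be a field and $S=K[x_1,\dots,x_5]$ with the standard grading. A $3$-uniform clutter $\mathcal C$ on $[5]=\{1,\dots,5\}$ is a set of $3$-element subsets of $[5]$, called circuits; its complement $\overline{\mathcal C}$ consists of the $3$-element subsets of $[5]$ that are not in $\mathcal C$, and its circuit ideal is $I(\mathcal C)=(\prod_{i\in F}x_i : F\in\mathcal C)\subseteq S$. A homogeneous ideal $I\ne 0$ of $S$ has a $d$-linear resolution if it is generated by homogeneous polynomials of degree $d$ and its graded Betti numbers (the numbers of summands $S(-j)$ in step $i$ of the minimal graded free resolution of $I$) satisfy $\beta_{i,j}(I)=0$ for all $i\ge 0$ and all $j\neq i+d$; it has a linear resolution if it has a $d$-linear resolution for some $d$. Let $\mathfrak T=\{\{1,2,4\},\{1,3,4\},\{2,3,4\},\{1,2,5\},\{1,3,5\},\{2,3,5\}\}$ be the hexahedron (the boundary of the triangular bipyramid over the triangle $123$ with apexes $4$ and $5$). Then: 1. $I(\overline{\mathfrak T})=(x_1x_4x_5,\;x_2x_4x_5,\;x_3x_4x_5,\;x_1x_2x_3)$, and this ideal does not have a linear resolution. 2. For every circuit $F\in\mathfrak T$,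 the ideal $I(\overline{\mathfrak T\setminus\{F\}})$ has a linear resolution, namely a $3$-linear resolution. -/

import Mathlib

/-- A clutter on the vertex set `V`: a set of subsets (the circuits), none of which contains
another one. -/
structure Clutter (V : Type*) where
  circuits : Finset (Finset V)
  antichain : ∀ e₁ ∈ circuits, ∀ e₂ ∈ circuits, e₁ ≠ e₂ → ¬ e₁ ⊆ e₂

namespace Clutter

/-- A clutter is `d`-uniform if every circuit has exactly `d` vertices. -/
def IsUniform {V : Type*} (C : Clutter V) (d : ℕ) : Prop :=
  ∀ F ∈ C.circuits, F.card = d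

/-- The complement of a `d`-uniform clutter: all `d`-subsets of the vertex set that are not
circuits. -/
def complement {V : Type*} [Fintype V] [DecidableEq V] (C : Clutter V) (d : ℕ) : Clutter V where
  circuits := Finset.powersetCard d Finset.univ \ C.circuits
  antichain := by
    intro e₁ h₁ e₂ h₂ hne hsub
    have c₁ := (Finset.mem_powersetCard.1 (Finset.mem_sdiff.1 h₁).1).2
    have c₂ := (Finset.mem_powersetCard.1 (Finset.mem_sdiff.1 h₂).1).2
    exact hne (Finset.eq_of_subset_of_card_le hsub (by omega))

/-- The clutter obtained by removing the circuit `F`. The vertex set is unchanged. -/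
def removeCircuit {V : Type*} [DecidableEq V] (C : Clutter V) (F : Finset V) : Clutter V where
  circuits := C.circuits.erase F
  antichain := fun e₁ h₁ e₂ h₂ =>
    C.antichain e₁ (Finset.mem_of_mem_erase h₁) e₂ (Finset.mem_of_mem_erase h₂)

/-- The ideal `I(C)` of `K[x_v : v ∈ V]` generated by the monomials `x_F = ∏_{v ∈ F} x_v`,
where `F` runs over the circuits of `C`. It is zero if `C` has no circuit. -/
noncomputable def circuitIdeal {V : Type*} (C : Clutter V) (K : Type*) [Field K] :
    Ideal (MvPolynomial V K) :=
  Ideal.span {m | ∃ F ∈ C.circuits, m = ∏ v ∈ F, MvPolynomial.X v}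

/-- The hexahedron (triangular bipyramid): the six triangles of the boundary of the bipyramid over
the triangle `1, 2, 3` with apexes `4` and `5`. The vertex with label `k` is `k - 1 : Fin 5`. -/
def hexahedron : Clutter (Fin 5) where
  circuits := {{0, 1, 3}, {0, 2, 3}, {1, 2, 3}, {0, 1, 4}, {0, 2, 4}, {1, 2, 4}}
  antichain := by decide

theorem hexahedron_isUniform : hexahedron.IsUniform 3 := by
  unfold IsUniform hexahedron
  decide

end Clutter

/-- An element `v = (v_b)_b` of the graded free module `⨁_b S(-deg b)`, `S = K[x_v : v ∈ V]` with
the standard grading, is homogeneous of degree `j`: each `v_b` is zero or a form of degree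
`j - deg b` (in particular it is zero if `j < deg b`). -/
def IsHomogeneousVector {V K ι : Type*} [Field K] (deg : ι → ℕ) (v : ι → MvPolynomial V K)
    (j : ℕ) : Prop :=
  ∀ b, ∀ m ∈ (v b).support, m.degree + deg b = j

/-- A minimal graded free resolution
`⋯ → F₂ → F₁ → F₀ → I → 0` of an ideal `I` of the standard graded polynomial ring
`S = K[x_v : v ∈ V]`. Here `F_i = ⨁_a S(-deg i a)` with `a` running over `Fin (rank i)`, the maps
are graded of degree zero, the sequence is exact, and `F_{i+1}` maps into `𝔪 F_i`, where `𝔪` is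
the ideal generated by the variables. -/
structure MinimalGradedFreeResolution {V K : Type*} [Field K] (I : Ideal (MvPolynomial V K)) where
  rank : ℕ → ℕ
  deg : (i : ℕ) → Fin (rank i) → ℕ
  /-- the surjection `F₀ → I`, as a map to `S` with image `I` -/
  aug : (Fin (rank 0) → MvPolynomial V K) →ₗ[MvPolynomial V K] MvPolynomial V K
  /-- the differentials `F_{i+1} → F_i` -/
  d : (i : ℕ) → (Fin (rank (i + 1)) → MvPolynomial V K) →ₗ[MvPolynomial V K]
    (Fin (rank i) → MvPolynomial V K)
  aug_homogeneous : ∀ a, (aug (Pi.single a 1)).IsHomogeneous (deg 0 a)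
  d_homogeneous : ∀ i a, IsHomogeneousVector (deg i) (d i (Pi.single a 1)) (deg (i + 1) a)
  range_aug : LinearMap.range aug = I
  exact_zero : Function.Exact (d 0) aug
  exact_succ : ∀ i, Function.Exact (d (i + 1)) (d i)
  minimal : ∀ i v b, d i v b ∈ Ideal.span (Set.range (MvPolynomial.X : V → MvPolynomial V K))

/-- The graded Betti number `β_{i,j}(I)`, read off from a minimal graded free resolution of `I`:
the number of summands `S(-j)` of `F_i`. It does not depend on the resolution, since minimal graded
free resolutions are unique up to isomorphism. -/
def MinimalGradedFreeResolution.betti {V K : Type*} [Field K] {I : Ideal (MvPolynomial V K)}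
    (F : MinimalGradedFreeResolution I) (i j : ℕ) : ℕ :=
  (Finset.univ.filter fun a => F.deg i a = j).card

/-- `I` has a `d`-linear resolution: `I` is generated by homogeneous polynomials of degree `d`, and
`β_{i,j}(I) = 0` for all `i` and all `j ≠ i + d`. -/
def HasLinearResolution {V K : Type*} [Field K] (d : ℕ) (I : Ideal (MvPolynomial V K)) : Prop :=
  (∃ G : Set (MvPolynomial V K), (∀ g ∈ G, g.IsHomogeneous d) ∧ I = Ideal.span G) ∧
  ∃ F : MinimalGradedFreeResolution I, ∀ i j, j ≠ i + d → F.betti i j = 0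

/-! All six removals are alike: removing the circuit `{a, b, p}` from the bipyramid over `a, b, c`
with apexes `p, q` leaves the complement with generators `apq, bpq, cpq, abp, abc`. An explicit
linear resolution `0 → S(-5) → S(-4)⁵ → S(-3)⁵` works: three first syzygies are the Koszul relations
among `a, b, c`, the other two link `bpq` to `abp` and `abp` to `abc`. Exactness (`exact_augMap`,
`exact_syzMatrix`) follows by peeling off divisibility by variables.

For the full bipyramid `abp` is missing and this link breaks: in any syzygy the coefficient of
`x₁x₂x₃` is divisible by `x₄x₅`, so linear syzygies cannot involve that generator, although the
quadratic relation `x₄x₅ · x₁x₂x₃ = x₂x₃ · x₁x₄x₅` does.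
`not_hasLinearResolution_span_bipyramidGens` makes this precise for an arbitrary resolution. -/

open MvPolynomial in
theorem X_dvd_of_X_dvd_X_mul {V K : Type*} [Field K] {i j : V} (hij : i ≠ j)
    {f : MvPolynomial V K} (h : (X i : MvPolynomial V K) ∣ X j * f) :
    (X i : MvPolynomial V K) ∣ f :=
  ((X_prime.dvd_or_dvd h).resolve_left fun h' => hij (X_dvd_X.1 h'))

open MvPolynomial in
theorem exists_of_X_mul_add_X_mul_eq_zero {V K : Type*} [Field K] {a b : V} (hab : a ≠ b)
    {f g : MvPolynomial V K} (h : X a * f + X b * g = 0) :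
    ∃ w, f = X b * w ∧ g = -(X a * w) := by
  obtain ⟨w, hw⟩ : (X b : MvPolynomial V K) ∣ f :=
    X_dvd_of_X_dvd_X_mul hab.symm ⟨-g, by linear_combination h⟩
  refine ⟨w, hw, mul_left_cancel₀ (X_ne_zero b) ?_⟩
  rw [hw] at h
  linear_combination h

open MvPolynomial in
-- Koszul exactness for three variables. Modulo `X a` and `X b` the relation forces `h` to vanish;
-- subtracting Koszul relations then leaves the two-variable case.
theorem exists_of_X_mul_add_X_mul_add_X_mul_eq_zero {V K : Type*} [Field K] {a b c : V}
    (hab : a ≠ b) (hac : a ≠ c) (hbc : b ≠ c) {f g h : MvPolynomial V K}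
    (H : X a * f + X b * g + X c * h = 0) :
    ∃ r s t, f = X b * r + X c * s ∧ g = -(X a * r) + X c * t ∧ h = -(X a * s) - X b * t := by
  classical
  have hmem : h ∈ Ideal.span (X '' ({a, b} : Set V) : Set (MvPolynomial V K)) := by
    rw [mem_ideal_span_X_image]
    intro m hm
    by_contra! hc
    have ha : m a = 0 := hc a (by simp)
    have hb : m b = 0 := hc b (by simp)
    -- This monomial contains neither `a` nor `b`, so only `X c * h` contributes.
    have := congrArg (coeff (Finsupp.single c 1 + m)) H
    rw [coeff_add, coeff_add, coeff_X_mul, coeff_X_mul', coeff_X_mul'] at this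
    simp [ha, hb, hac.symm, hbc.symm] at this
    exact mem_support_iff.1 hm this
  rw [Set.image_pair, Ideal.mem_span_pair] at hmem
  obtain ⟨p, q, hpq⟩ := hmem
  have H' : X a * (f + X c * p) + X b * (g + X c * q) = 0 := by
    rw [← hpq] at H
    linear_combination H
  obtain ⟨r, hr, hr'⟩ := exists_of_X_mul_add_X_mul_eq_zero hab H'
  exact ⟨r, -p, -q, by linear_combination hr, by linear_combination hr',
    by linear_combination -hpq⟩

theorem isHomogeneousVector_of_isHomogeneous_one {V K ι : Type*} [Field K] {deg : ι → ℕ}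
    {v : ι → MvPolynomial V K} {j : ℕ} (hdeg : ∀ b, 1 + deg b = j)
    (hv : ∀ b, (v b).IsHomogeneous 1) : IsHomogeneousVector deg v j := by
  intro b m hm
  have h := (hv b).degree_eq_sum_deg_support hm
  rw [Finsupp.degree_apply, ← hdeg b, h]

/-! ### The linear resolution after removing a circuit -/

namespace Bipyramid

open MvPolynomial

section maps

variable {V K : Type*} [Field K] (a b c p q : V)

/-- The five generators of the circuit ideal of the complement of the bipyramid over `a, b, c` with
apexes `p, q` from which the circuit `a, b, p` is removed. -/
noncomputable def gens : Fin 5 → MvPolynomial V K :=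
  ![X a * X p * X q, X b * X p * X q, X c * X p * X q, X a * X b * X p, X a * X b * X c]

/-- The map from the free module of rank five given by `gens`. -/
noncomputable def augMap : (Fin 5 → MvPolynomial V K) →ₗ[MvPolynomial V K] MvPolynomial V K :=
  Fintype.linearCombination (MvPolynomial V K) (gens a b c p q)

/-- The matrix of the linear syzygies of `gens`. -/
noncomputable def syzMatrix : Matrix (Fin 5) (Fin 5) (MvPolynomial V K) :=
  !![X b, X c, 0, 0, 0;
     -X a, 0, X c, -X a, 0;
     0, -X a, -X b, 0, 0;
     0, 0, 0, X q, -X c;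
     0, 0, 0, 0, X p]

/-- The matrix of the linear second syzygies of `gens`. -/
noncomputable def syzMatrix₂ : Matrix (Fin 5) (Fin 1) (MvPolynomial V K) :=
  !![X c; -X b; X a; 0; 0]

theorem augMap_apply (u : Fin 5 → MvPolynomial V K) :
    augMap a b c p q u = u 0 * (X a * X p * X q) + u 1 * (X b * X p * X q)
      + u 2 * (X c * X p * X q) + u 3 * (X a * X b * X p) + u 4 * (X a * X b * X c) := by
  simp [augMap, gens, Fintype.linearCombination_apply, Fin.sum_univ_five]

theorem syzMatrix_mulVec (v : Fin 5 → MvPolynomial V K) :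
    (syzMatrix a b c p q).mulVec v = ![X b * v 0 + X c * v 1,
      -(X a * v 0) + X c * v 2 - X a * v 3, -(X a * v 1) - X b * v 2,
      X q * v 3 - X c * v 4, X p * v 4] := by
  funext i
  fin_cases i <;> simp [syzMatrix, Matrix.mulVec, dotProduct, Fin.sum_univ_five] <;> ring

theorem syzMatrix₂_mulVec (v : Fin 1 → MvPolynomial V K) :
    (syzMatrix₂ a b c).mulVec v = ![X c * v 0, -(X b * v 0), X a * v 0, 0, 0] := by
  funext i
  fin_cases i <;> simp [syzMatrix₂, Matrix.mulVec, dotProduct]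

theorem range_augMap :
    LinearMap.range (augMap (K := K) a b c p q) = Ideal.span (Set.range (gens a b c p q)) :=
  Fintype.range_linearCombination _ _

theorem gens_isHomogeneous (i : Fin 5) : (gens (K := K) a b c p q i).IsHomogeneous 3 := by
  have h (i j k : V) : (X i * X j * X k : MvPolynomial V K).IsHomogeneous 3 :=
    ((isHomogeneous_X K i).mul (isHomogeneous_X K j)).mul (isHomogeneous_X K k)
  fin_cases i <;> exact h _ _ _

theorem syzMatrix_isHomogeneous (i j : Fin 5) :
    (syzMatrix (K := K) a b c p q i j).IsHomogeneous 1 := by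
  fin_cases i <;> fin_cases j <;>
    first
    | exact isHomogeneous_X K _
    | exact (isHomogeneous_X K _).neg
    | exact isHomogeneous_zero _ _ _

theorem syzMatrix₂_isHomogeneous (i : Fin 5) (j : Fin 1) :
    (syzMatrix₂ (K := K) a b c i j).IsHomogeneous 1 := by
  fin_cases i <;> fin_cases j <;>
    first
    | exact isHomogeneous_X K _
    | exact (isHomogeneous_X K _).neg
    | exact isHomogeneous_zero _ _ _

variable {a b c p q}

theorem exact_augMap (hab : a ≠ b) (hac : a ≠ c) (hbc : b ≠ c) (hpa : p ≠ a) (hpb : p ≠ b)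
    (hpc : p ≠ c) (hqa : q ≠ a) (hqb : q ≠ b) :
    Function.Exact (syzMatrix (K := K) a b c p q).mulVecLin (augMap a b c p q) := by
  intro u
  constructor
  · intro hu
    rw [augMap_apply] at hu
    -- Only the generator `abc` is not divisible by `X p`.
    obtain ⟨v₄, h₄⟩ : (X p : MvPolynomial V K) ∣ u 4 :=
      X_dvd_of_X_dvd_X_mul hpa <| X_dvd_of_X_dvd_X_mul hpb <| X_dvd_of_X_dvd_X_mul hpc
        ⟨-(u 0 * (X a * X q) + u 1 * (X b * X q) + u 2 * (X c * X q) + u 3 * (X a * X b)),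
          by linear_combination hu⟩
    have hu' : u 0 * (X a * X q) + u 1 * (X b * X q) + u 2 * (X c * X q) + u 3 * (X a * X b)
        + X a * X b * X c * v₄ = 0 := by
      apply mul_left_cancel₀ (X_ne_zero (R := K) p)
      rw [h₄] at hu
      linear_combination hu
    -- With `X p` cancelled, the terms without a factor `X q` add up to `ab(u 3 + c v₄)`.
    obtain ⟨v₃, h₃⟩ : (X q : MvPolynomial V K) ∣ u 3 + X c * v₄ :=
      X_dvd_of_X_dvd_X_mul hqa <| X_dvd_of_X_dvd_X_mul hqb
        ⟨-(u 0 * X a + u 1 * X b + u 2 * X c), by linear_combination hu'⟩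
    have hu'' : X a * u 0 + X b * (u 1 + X a * v₃) + X c * u 2 = 0 := by
      apply mul_left_cancel₀ (X_ne_zero (R := K) q)
      linear_combination hu' - X a * X b * h₃
    obtain ⟨r, s, t, h₀, h₁, h₂⟩ :=
      exists_of_X_mul_add_X_mul_add_X_mul_eq_zero hab hac hbc hu''
    refine ⟨![r, s, t, v₃, v₄], ?_⟩
    rw [Matrix.mulVecLin_apply, syzMatrix_mulVec]
    funext i
    fin_cases i
    · exact h₀.symm
    · change -(X a * r) + X c * t - X a * v₃ = u 1
      linear_combination -h₁
    · exact h₂.symm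
    · change X q * v₃ - X c * v₄ = u 3
      linear_combination -h₃
    · exact h₄.symm
  · rintro ⟨v, rfl⟩
    rw [Matrix.mulVecLin_apply, syzMatrix_mulVec, augMap_apply]
    simp
    ring

/-- The last two rows kill `v 3` and `v 4`; what remains is a second syzygy of the Koszul complex on
`a, b, c`. -/
theorem exact_syzMatrix (hbc : b ≠ c) :
    Function.Exact (syzMatrix₂ (K := K) a b c).mulVecLin (syzMatrix a b c p q).mulVecLin := by
  intro v
  rw [Matrix.mulVecLin_apply, syzMatrix_mulVec]
  constructor
  · intro hv
    have e₀ : X b * v 0 + X c * v 1 = 0 := congrFun hv 0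
    have e₂ : -(X a * v 1) - X b * v 2 = 0 := congrFun hv 2
    have e₃ : X q * v 3 - X c * v 4 = 0 := congrFun hv 3
    have e₄ : X p * v 4 = 0 := congrFun hv 4
    have h₄ : v 4 = 0 := (mul_eq_zero.1 e₄).resolve_left (X_ne_zero p)
    have h₃ : v 3 = 0 := by
      rw [h₄, mul_zero, sub_zero] at e₃
      exact (mul_eq_zero.1 e₃).resolve_left (X_ne_zero q)
    obtain ⟨w, h₀, h₁⟩ := exists_of_X_mul_add_X_mul_eq_zero hbc e₀
    have h₂ : X a * w = v 2 := by
      apply mul_left_cancel₀ (X_ne_zero (R := K) b)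
      rw [h₁] at e₂
      linear_combination e₂
    refine ⟨![w], ?_⟩
    rw [Matrix.mulVecLin_apply, syzMatrix₂_mulVec]
    funext i
    fin_cases i
    · exact h₀.symm
    · exact h₁.symm
    · exact h₂
    · exact h₃.symm
    · exact h₄.symm
  · rintro ⟨w, rfl⟩
    rw [Matrix.mulVecLin_apply, syzMatrix₂_mulVec]
    funext i
    fin_cases i <;> simp <;> ring

theorem syzMatrix₂_injective :
    Function.Injective (syzMatrix₂ (K := K) a b c).mulVecLin := by
  rw [← LinearMap.ker_eq_bot, LinearMap.ker_eq_bot']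
  intro w hw
  rw [Matrix.mulVecLin_apply, syzMatrix₂_mulVec] at hw
  have h : X c * w 0 = 0 := congrFun hw 0
  funext i
  rw [Subsingleton.elim i 0]
  exact (mul_eq_zero.1 h).resolve_left (X_ne_zero c)

end maps

theorem mem_span_range_X_of_isHomogeneous_one {V K : Type*} [Field K] {f : MvPolynomial V K}
    (hf : f.IsHomogeneous 1) : f ∈ Ideal.span (Set.range (X : V → MvPolynomial V K)) := by
  rw [← Set.image_univ, mem_ideal_span_X_image]
  intro m hm
  by_contra! h
  have hm0 : m = 0 := Finsupp.ext fun i => h i (Set.mem_univ i)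
  have := hf.degree_eq_sum_deg_support hm
  simp [hm0] at this

theorem mulVec_mem_of_isHomogeneous_one {V K : Type*} [Field K] {k l : ℕ}
    {M : Matrix (Fin k) (Fin l) (MvPolynomial V K)} (hM : ∀ i j, (M i j).IsHomogeneous 1)
    (v : Fin l → MvPolynomial V K) (i : Fin k) :
    M.mulVecLin v i ∈ Ideal.span (Set.range (X : V → MvPolynomial V K)) := by
  rw [Matrix.mulVecLin_apply, Matrix.mulVec, dotProduct]
  exact Ideal.sum_mem _ fun j _ =>
    Ideal.mul_mem_right _ _ (mem_span_range_X_of_isHomogeneous_one (hM i j))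

/-- The ranks of the resolution of `gens`. -/
def resRank : ℕ → ℕ
  | 0 => 5
  | 1 => 5
  | 2 => 1
  | _ + 3 => 0

/-- The matrices of the resolution of `gens`. -/
noncomputable def resMatrix {V K : Type*} [Field K] (a b c p q : V) :
    (i : ℕ) → Matrix (Fin (resRank i)) (Fin (resRank (i + 1))) (MvPolynomial V K)
  | 0 => syzMatrix a b c p q
  | 1 => syzMatrix₂ a b c
  | _ + 2 => 0

theorem resMatrix_isHomogeneous {V K : Type*} [Field K] (a b c p q : V) :
    ∀ i k l, (resMatrix (K := K) a b c p q i k l).IsHomogeneous 1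
  | 0 => syzMatrix_isHomogeneous a b c p q
  | 1 => syzMatrix₂_isHomogeneous a b c
  | _ + 2 => fun _ _ => isHomogeneous_zero _ _ _

theorem exact_resMatrix {V K : Type*} [Field K] {a b c p q : V} (hbc : b ≠ c) :
    ∀ i, Function.Exact (resMatrix (K := K) a b c p q (i + 1)).mulVecLin
      (resMatrix (K := K) a b c p q i).mulVecLin
  | 0 => exact_syzMatrix hbc
  -- The incoming module has rank zero, so exactness is injectivity of `syzMatrix₂`.
  | 1 => by
    intro w
    refine ⟨fun hw => ⟨0, ?_⟩, ?_⟩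
    · rw [map_zero]
      exact (syzMatrix₂_injective (hw.trans (map_zero _).symm)).symm
    · rintro ⟨v, rfl⟩
      have : v = 0 := funext fun i => i.elim0
      rw [this, map_zero, map_zero]
  | n + 2 => fun w => by
    have hw : w = 0 := funext fun i => i.elim0
    subst hw
    exact ⟨fun _ => ⟨0, map_zero _⟩, fun _ => map_zero _⟩

/-- The linear minimal graded free resolution of the ideal generated by `gens`. -/
noncomputable def resolution {V K : Type*} [Field K] {a b c p q : V} (hab : a ≠ b) (hac : a ≠ c)
    (hbc : b ≠ c) (hpa : p ≠ a) (hpb : p ≠ b) (hpc : p ≠ c) (hqa : q ≠ a) (hqb : q ≠ b) :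
    MinimalGradedFreeResolution (Ideal.span (Set.range (gens (K := K) a b c p q))) where
  rank := resRank
  deg i _ := i + 3
  aug := augMap a b c p q
  d i := (resMatrix a b c p q i).mulVecLin
  aug_homogeneous i := by
    have h : augMap (K := K) a b c p q (Pi.single i 1) = gens a b c p q i := by
      exact (Fintype.linearCombination_apply_single _ _ _ _).trans (one_smul _ _)
    exact h ▸ gens_isHomogeneous a b c p q i
  d_homogeneous i k := by
    refine isHomogeneousVector_of_isHomogeneous_one (fun _ => by omega) fun l => ?_
    rw [Matrix.mulVecLin_apply, Matrix.mulVec_single_one]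
    exact resMatrix_isHomogeneous a b c p q i l k
  range_aug := range_augMap a b c p q
  exact_zero := exact_augMap hab hac hbc hpa hpb hpc hqa hqb
  exact_succ := exact_resMatrix hbc
  minimal i v k := mulVec_mem_of_isHomogeneous_one (resMatrix_isHomogeneous a b c p q i) v k

theorem hasLinearResolution {V K : Type*} [Field K] {a b c p q : V} (hab : a ≠ b) (hac : a ≠ c)
    (hbc : b ≠ c) (hpa : p ≠ a) (hpb : p ≠ b) (hpc : p ≠ c) (hqa : q ≠ a) (hqb : q ≠ b) :
    HasLinearResolution 3 (Ideal.span (Set.range (gens (K := K) a b c p q))) := by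
  refine ⟨⟨_, ?_, rfl⟩, resolution hab hac hbc hpa hpb hpc hqa hqb, fun i j hj => ?_⟩
  · rintro _ ⟨i, rfl⟩
    exact gens_isHomogeneous a b c p q i
  · rw [MinimalGradedFreeResolution.betti, Finset.card_eq_zero, Finset.filter_eq_empty_iff]
    exact fun _ _ h => hj h.symm

theorem prod_X_triple {V K : Type*} [Field K] [DecidableEq V] {i j k : V} (hij : i ≠ j)
    (hik : i ≠ k) (hjk : j ≠ k) :
    ∏ v ∈ ({i, j, k} : Finset V), (X v : MvPolynomial V K) = X i * X j * X k := by
  rw [Finset.prod_insert (by simp [hij, hik]), Finset.prod_pair hjk, mul_assoc]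

theorem circuitIdeal_hasLinearResolution {V K : Type*} [Field K] [DecidableEq V] (C : Clutter V)
    {a b c p q : V} (hab : a ≠ b) (hac : a ≠ c) (hbc : b ≠ c) (hpa : p ≠ a) (hpb : p ≠ b)
    (hpc : p ≠ c) (hqa : q ≠ a) (hqb : q ≠ b) (hqc : q ≠ c) (hpq : p ≠ q)
    (hC : C.circuits = {{a, p, q}, {b, p, q}, {c, p, q}, {a, b, p}, {a, b, c}}) :
    HasLinearResolution 3 (C.circuitIdeal K) := by
  have hset : {m : MvPolynomial V K | ∃ F ∈ C.circuits, m = ∏ v ∈ F, X v}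
      = Set.range (gens a b c p q) := by
    ext m
    simp only [hC, Finset.mem_insert, Finset.mem_singleton, exists_eq_or_imp, exists_eq_left,
      Set.mem_ofPred_eq, prod_X_triple hpa.symm hqa.symm hpq, prod_X_triple hpb.symm hqb.symm hpq,
      prod_X_triple hpc.symm hqc.symm hpq, prod_X_triple hab hpa.symm hpb.symm,
      prod_X_triple hab hac hbc]
    simp only [gens, Matrix.range_cons, Matrix.range_empty, Set.union_empty, Set.mem_union,
      Set.mem_singleton_iff]
  rw [Clutter.circuitIdeal, hset]
  exact hasLinearResolution hab hac hbc hpa hpb hpc hqa hqb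

/-! ### The full bipyramid has no linear resolution -/

theorem circuitIdeal_complement_hexahedron {K : Type*} [Field K] :
    (Clutter.hexahedron.complement 3).circuitIdeal K =
      Ideal.span ({X 0 * X 3 * X 4, X 1 * X 3 * X 4, X 2 * X 3 * X 4, X 0 * X 1 * X 2} :
        Set (MvPolynomial (Fin 5) K)) := by
  have hC : (Clutter.hexahedron.complement 3).circuits
      = {{0, 3, 4}, {1, 3, 4}, {2, 3, 4}, {0, 1, 2}} := by decide
  rw [Clutter.circuitIdeal, hC]
  congr 1
  ext m
  simp only [Finset.mem_insert, Finset.mem_singleton, exists_eq_or_imp, exists_eq_left,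
    Set.mem_ofPred_eq, Set.mem_insert_iff, Set.mem_singleton_iff]
  rw [prod_X_triple (by decide) (by decide) (by decide),
    prod_X_triple (by decide) (by decide) (by decide),
    prod_X_triple (by decide) (by decide) (by decide),
    prod_X_triple (by decide) (by decide) (by decide)]

/-- The generators of the circuit ideal of the complement of the bipyramid. -/
def bipyramidGens (K : Type*) [Field K] : Set (MvPolynomial (Fin 5) K) :=
  {X 0 * X 3 * X 4, X 1 * X 3 * X 4, X 2 * X 3 * X 4, X 0 * X 1 * X 2}

theorem X_mul_X_mul_X_eq_monomial {V K : Type*} [Field K] (i j k : V) :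
    (X i * X j * X k : MvPolynomial V K)
      = monomial (Finsupp.single i 1 + Finsupp.single j 1 + Finsupp.single k 1) 1 := by
  simp [X, monomial_mul]

theorem exists_le_of_mem_span_bipyramidGens {K : Type*} [Field K] {f : MvPolynomial (Fin 5) K}
    (hf : f ∈ Ideal.span (bipyramidGens K)) {m : Fin 5 →₀ ℕ} (hm : m ∈ f.support) :
    (1 ≤ m 3 ∧ 1 ≤ m 4 ∧ 3 ≤ m.degree) ∨ (1 ≤ m 0 ∧ 1 ≤ m 1 ∧ 1 ≤ m 2) := by
  let e : Fin 5 → Fin 5 → Fin 5 → Fin 5 →₀ ℕ := fun i j k =>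
    Finsupp.single i 1 + Finsupp.single j 1 + Finsupp.single k 1
  have himage : bipyramidGens K = (fun s => monomial s (1 : K)) ''
      {e 0 3 4, e 1 3 4, e 2 3 4, e 0 1 2} := by
    simp only [Set.image_insert_eq, Set.image_singleton, bipyramidGens,
      X_mul_X_mul_X_eq_monomial, e]
  rw [himage, mem_ideal_span_monomial_image] at hf
  obtain ⟨s, hs, hsm⟩ := hf m hm
  have hdeg : m.degree = m 0 + m 1 + m 2 + m 3 + m 4 := by
    rw [Finsupp.degree_eq_sum, Fin.sum_univ_five]
  have hle (i : Fin 5) := hsm i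
  rw [hdeg]
  have h0 := hle 0
  have h1 := hle 1
  have h2 := hle 2
  have h3 := hle 3
  have h4 := hle 4
  rcases hs with rfl | rfl | rfl | rfl <;> simp [e] at h0 h1 h2 h3 h4 <;> omega

theorem exists_eq_of_mem_span_bipyramidGens {K : Type*} [Field K] {f : MvPolynomial (Fin 5) K}
    (hf : f ∈ Ideal.span (bipyramidGens K)) {d : ℕ} (hd : d ≤ 3) (hfd : f.IsHomogeneous d) :
    ∃ (r : K) (g : MvPolynomial (Fin 5) K), f = C r * (X 0 * X 1 * X 2) + X 3 * X 4 * g := by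
  let s : Fin 5 →₀ ℕ := Finsupp.single 0 1 + Finsupp.single 1 1 + Finsupp.single 2 1
  have hmem : f - monomial s (coeff s f) ∈ Ideal.span ((fun t => monomial t (1 : K)) ''
      {Finsupp.single (3 : Fin 5) 1 + Finsupp.single 4 1}) := by
    rw [mem_ideal_span_monomial_image]
    intro m hm
    refine ⟨_, rfl, ?_⟩
    rw [mem_support_iff, coeff_sub, coeff_monomial] at hm
    have hms : s ≠ m := by
      rintro rfl
      simp at hm
    rw [if_neg hms, sub_zero] at hm
    have hmd := hfd.degree_eq_sum_deg_support (mem_support_iff.2 hm)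
    have hle : 1 ≤ m 3 ∧ 1 ≤ m 4 := by
      rcases exists_le_of_mem_span_bipyramidGens hf (mem_support_iff.2 hm) with h | h
      · exact ⟨h.1, h.2.1⟩
      -- A multiple of `x₀x₁x₂` of degree at most 3 is `x₀x₁x₂` itself.
      · refine absurd (Finsupp.ext fun i => ?_) hms
        rw [← Finsupp.degree_apply, Finsupp.degree_eq_sum, Fin.sum_univ_five] at hmd
        fin_cases i <;> simp [s] <;> omega
    intro i
    fin_cases i <;> simp [hle]
  rw [Set.image_singleton, Ideal.mem_span_singleton] at hmem
  obtain ⟨g, hg⟩ := hmem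
  refine ⟨coeff s f, g, ?_⟩
  rw [X_mul_X_mul_X_eq_monomial, C_mul_monomial, mul_one]
  have : (X 3 * X 4 : MvPolynomial (Fin 5) K)
      = monomial (Finsupp.single 3 1 + Finsupp.single 4 1) 1 := by
    simp [X, monomial_mul]
  rw [this, ← hg, add_sub_cancel]

theorem not_hasLinearResolution_span_bipyramidGens {K : Type*} [Field K] (d : ℕ) :
    ¬ HasLinearResolution d (Ideal.span (bipyramidGens K)) := by
  rintro ⟨-, F, hF⟩
  have hdeg (i : ℕ) (a : Fin (F.rank i)) : F.deg i a = i + d := by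
    by_contra h
    have := hF i _ h
    rw [MinimalGradedFreeResolution.betti, Finset.card_eq_zero,
      Finset.filter_eq_empty_iff] at this
    exact this (Finset.mem_univ a) rfl
  let f : Fin (F.rank 0) → MvPolynomial (Fin 5) K := fun a => F.aug (Pi.single a 1)
  have haug (u : Fin (F.rank 0) → MvPolynomial (Fin 5) K) : F.aug u = ∑ a, u a * f a := by
    conv_lhs => rw [pi_eq_sum_univ' u]
    rw [map_sum]
    refine Finset.sum_congr rfl fun a _ => ?_
    rw [map_smul, smul_eq_mul]
  have hfd (a) : (f a).IsHomogeneous d := by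
    have := F.aug_homogeneous a
    rwa [hdeg, zero_add] at this
  have hfI (a) : f a ∈ Ideal.span (bipyramidGens K) := by
    rw [← F.range_aug]
    exact LinearMap.mem_range_self _ _
  have hlift {g} (hg : g ∈ bipyramidGens K) : ∃ v, F.aug v = g := by
    have := Ideal.subset_span hg
    rwa [← F.range_aug] at this
  obtain ⟨v, hv⟩ := hlift (g := X 0 * X 1 * X 2) (by simp [bipyramidGens])
  obtain ⟨w, hw⟩ := hlift (g := X 0 * X 3 * X 4) (by simp [bipyramidGens])
  -- Otherwise the ideal would lie in the fourth power of the maximal ideal, yet it contains a cubic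
  -- monomial.
  have hd : d ≤ 3 := by
    by_contra! hd
    have hmem : (X 0 * X 1 * X 2 : MvPolynomial (Fin 5) K) ∈ idealOfVars (Fin 5) K ^ 4 := by
      rw [← hv, haug]
      refine Ideal.sum_mem _ fun a _ => Ideal.mul_mem_left _ _ ?_
      rw [mem_pow_idealOfVars_iff']
      exact fun m hm => (hfd a).coeff_eq_zero (by omega)
    rw [X_mul_X_mul_X_eq_monomial, monomial_mem_pow_idealOfVars_iff _ _ one_ne_zero] at hmem
    simp at hmem
  choose r g hfg using fun a => exists_eq_of_mem_span_bipyramidGens (hfI a) hd (hfd a)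
  -- `φ` records the coefficient of `x₀x₁x₂`, taken modulo multiples of `x₃x₄`.
  let φ : (Fin (F.rank 0) → MvPolynomial (Fin 5) K) →ₗ[MvPolynomial (Fin 5) K]
    MvPolynomial (Fin 5) K := Fintype.linearCombination _ fun a => C (r a)
  have hφ (u) : φ u = ∑ a, u a * C (r a) := rfl
  have haugφ (u) : ∃ h, F.aug u = φ u * (X 0 * X 1 * X 2) + X 3 * X 4 * h := by
    refine ⟨∑ a, u a * g a, ?_⟩
    rw [haug, hφ, Finset.sum_mul, Finset.mul_sum, ← Finset.sum_add_distrib]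
    refine Finset.sum_congr rfl fun a _ => ?_
    rw [hfg]
    ring
  -- Linearity of the resolution makes this value a linear form, and it is divisible by `x₃x₄`.
  have hφd (a) : φ (F.d 0 (Pi.single a 1)) = 0 := by
    set u := F.d 0 (Pi.single a 1) with hu
    have hu0 : F.aug u = 0 := (F.exact_zero _).2 ⟨_, rfl⟩
    have hhom : (φ u).IsHomogeneous 1 := by
      rw [hφ]
      refine IsHomogeneous.sum _ _ _ fun b _ => ?_
      rw [mul_comm]
      refine IsHomogeneous.C_mul ?_ _
      intro m hm
      have := F.d_homogeneous 0 a b m (mem_support_iff.2 hm)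
      rw [hdeg, hdeg] at this
      change Finsupp.weight (fun _ => 1) m = 1
      rw [← Finsupp.degree_eq_weight_one]
      omega
    obtain ⟨h, hh⟩ := haugφ u
    rw [hu0] at hh
    obtain ⟨t, ht⟩ : (X 3 : MvPolynomial (Fin 5) K) ∣ φ u :=
      X_dvd_of_X_dvd_X_mul (j := 0) (by decide) <| X_dvd_of_X_dvd_X_mul (j := 1) (by decide) <|
        X_dvd_of_X_dvd_X_mul (j := 2) (by decide) ⟨-(X 4 * h), by linear_combination -hh⟩
    obtain ⟨t', rfl⟩ : (X 4 : MvPolynomial (Fin 5) K) ∣ t :=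
      X_dvd_of_X_dvd_X_mul (j := 3) (by decide) <| X_dvd_of_X_dvd_X_mul (j := 0) (by decide) <|
        X_dvd_of_X_dvd_X_mul (j := 1) (by decide) <|
        X_dvd_of_X_dvd_X_mul (j := 2) (by decide)
          ⟨-(X 3 * h), by rw [ht] at hh; linear_combination -hh⟩
    rw [ht]
    by_contra hne
    have ht' : t' ≠ 0 := by
      rintro rfl
      simp at hne
    have h1 := hhom.totalDegree (ht ▸ hne)
    rw [ht, totalDegree_mul_of_isDomain (X_ne_zero _) (mul_ne_zero (X_ne_zero _) ht'),
      totalDegree_mul_of_isDomain (X_ne_zero _) ht', totalDegree_X, totalDegree_X] at h1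
    omega
  have hφker (u) (hu : F.aug u = 0) : φ u = 0 := by
    obtain ⟨y, rfl⟩ := (F.exact_zero u).1 hu
    have : φ ∘ₗ F.d 0 = 0 := LinearMap.pi_ext' fun a => LinearMap.ext_ring (by simpa using hφd a)
    exact LinearMap.congr_fun this y
  -- The quadratic syzygy between `x₀x₁x₂` and `x₀x₃x₄`, lifted to `F₀`.
  have hvw := hφker ((X 3 * X 4 : MvPolynomial (Fin 5) K) • v
    - (X 1 * X 2 : MvPolynomial (Fin 5) K) • w) (by
      rw [map_sub, map_smul, map_smul, hv, hw, smul_eq_mul, smul_eq_mul]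
      ring)
  rw [map_sub, map_smul, map_smul, smul_eq_mul, smul_eq_mul] at hvw
  obtain ⟨s, hs⟩ : (X 1 : MvPolynomial (Fin 5) K) ∣ φ v :=
    X_dvd_of_X_dvd_X_mul (j := 3) (by decide) <| X_dvd_of_X_dvd_X_mul (j := 4) (by decide)
      ⟨X 2 * φ w, by linear_combination hvw⟩
  obtain ⟨h, hh⟩ := haugφ v
  rw [hv] at hh
  -- `φ v` is 1 modulo `x₃`, but divisible by `x₁`: the constant terms disagree.
  obtain ⟨t, ht⟩ : (X 3 : MvPolynomial (Fin 5) K) ∣ 1 - φ v :=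
    X_dvd_of_X_dvd_X_mul (j := 0) (by decide) <| X_dvd_of_X_dvd_X_mul (j := 1) (by decide) <|
      X_dvd_of_X_dvd_X_mul (j := 2) (by decide) ⟨X 4 * h, by linear_combination hh⟩
  have := congrArg constantCoeff ht
  rw [hs] at this
  simp at this

end Bipyramid

/-! ### The hexahedron -/

open MvPolynomial in
theorem mainTheorem8 {K : Type*} [Field K] :
    ((Clutter.hexahedron.complement 3).circuitIdeal K =
        Ideal.span ({X 0 * X 3 * X 4, X 1 * X 3 * X 4, X 2 * X 3 * X 4, X 0 * X 1 * X 2} :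
          Set (MvPolynomial (Fin 5) K))) ∧
      (¬ ∃ d : ℕ, HasLinearResolution d ((Clutter.hexahedron.complement 3).circuitIdeal K)) ∧
      ∀ F ∈ Clutter.hexahedron.circuits,
        HasLinearResolution 3
          (((Clutter.hexahedron.removeCircuit F).complement 3).circuitIdeal K) := by
  refine ⟨Bipyramid.circuitIdeal_complement_hexahedron, ?_, ?_⟩
  · rintro ⟨d, hd⟩
    rw [Bipyramid.circuitIdeal_complement_hexahedron] at hd
    exact Bipyramid.not_hasLinearResolution_span_bipyramidGens d hd
  · intro F hF
    -- The removed circuit is `{a, b, p}`, so `c` is the remaining triangle vertex and `q` the other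
    -- apex.
    have h : ∃ a b c p q : Fin 5, a ≠ b ∧ a ≠ c ∧ b ≠ c ∧ p ≠ a ∧ p ≠ b ∧ p ≠ c ∧ q ≠ a ∧ q ≠ b ∧
        q ≠ c ∧ p ≠ q ∧ ((Clutter.hexahedron.removeCircuit F).complement 3).circuits =
          {{a, p, q}, {b, p, q}, {c, p, q}, {a, b, p}, {a, b, c}} := by
      simp only [Clutter.hexahedron, Finset.mem_insert, Finset.mem_singleton] at hF
      rcases hF with rfl | rfl | rfl | rfl | rfl | rfl
      · exact ⟨0, 1, 2, 3, 4, by decide⟩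
      · exact ⟨0, 2, 1, 3, 4, by decide⟩
      · exact ⟨1, 2, 0, 3, 4, by decide⟩
      · exact ⟨0, 1, 2, 4, 3, by decide⟩
      · exact ⟨0, 2, 1, 4, 3, by decide⟩
      · exact ⟨1, 2, 0, 4, 3, by decide⟩
    obtain ⟨a, b, c, p, q, hab, hac, hbc, hpa, hpb, hpc, hqa, hqb, hqc, hpq, hC⟩ := h
    exact Bipyramid.circuitIdeal_hasLinearResolution _ hab hac hbc hpa hpb hpc hqa hqb hqc hpq hC
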